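/- **Setting.** Let $F_i(x)=\tfrac12x+\tfrac12q_i$ ($i=0,1,2$), where $q_0=(0,0)$, $q_1=(1,0)$, $q_2=(\tfrac12,\tfrac{\sqrt3}2)$, let $V_0=\{q_0,q_1,q_2\}$ and $V_n=\bigcup_iF_i(V_{n-1})$, and let $x\sim_m y$ mean $x=F_w(q_i)$, $y=F_w(q_j)$ for some word $w$ of length $m$ and some $i\ne j$, where $F_w=F_{w_1}\circ\cdots\circ F_{w_m}$; put $\Delta_mu(x)=\sum_{y\sim_mx}(u(y)-u(x))$. For a sequence $\mathcal K=(k_n)_{n\ge1}$ in $\{0,1,2\}$, the infinite Sierpinski gasket $SG_\infty=\bigcup_{M\geq 1}F_{\mathcal K,M}^{-1}(SG)$, $F_{\mathcal K,M}=F_{k_M}\circ\cdots\circ F_{k_1}$, is approximated by the graphs with vertex sets $V_{(m)}=\bigcup_{M\ge1,\,M+m\ge0}F_{\mathcal K,M}^{-1}V_{M+m}$, $m\in\mathbb Z$, where $x\sim_{(m)}y$ iff $F_{\mathcal K,M}(x)\sim_{m+M}F_{\mathcal K,M}(y)$ for some $M$; put $\Delta_{(m)}u(x)=\sum_{y\sim_{(m)}x}(u(y)-u(x))$.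 An *initial function* with generation of birth $m_0$ and initial eigenvalue $\lambda_{m_0}\in\{2,5,6\}$ is a function $f\neq0$ on $V_{m_0}$ ($m_0\in\mathbb N$, for $SG$) with $-\Delta_{m_0}f=\lambda_{m_0}f$ on $V_{m_0}\setminus V_0$, or a function $f\ne0$ on $V_{(m_0)}$ ($m_0\in\mathbb Z$, for $SG_\infty$) with $-\Delta_{(m_0)}f=\lambda_{m_0}f$ at all vertices that are not boundary points of $SG_\infty$, i.e. at all $x$ with $F_{\mathcal K,M}(x)\in V_{M+m_0}\setminus V_0$ for some $M\ge 1$ with $M+m_0\geq 0$. Let $\psi_\pm(x)=\frac{5\pm\sqrt{25-4x}}2$ and $\Psi(x)=\frac32\lim_{l\to\infty}5^l\psi_-^l(x)$, where $\psi_-^l$ is the $l$-fold iterate. Let $E$ consist of the empty sequence and of all finite sequences $e=(e_1,\dots,e_N)$ of signs with $e_1=+$; let $|e|$ be the length of $e$ and $\psi_e=\psi_{e_1}\circ\cdots\circ\psi_{e_{|e|}}$ ($\psi_\emptyset=\mathrm{id}$). The spectral-decimation eigenvalues arising from the initial function are, for $e\in E$, $$\lambda_e=5^{|e|+m_0}\,\Psi(\psi_e(\lambda_{m_0}))\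 \text{ if }\lambda_{m_0}\in\{2,5\},\qquad \lambda_e=5^{|e|+m_0+1}\,\Psi(\psi_e(\psi_+(6)))\ \text{ if }\lambda_{m_0}=6,$$ where $\psi_+(6)=3$. Let $\rho_{m_0}(x)=\#\{e\in E:\lambda_e\le x\}$. **Proposition 5.3 (eigenvalue counting asymptotics).** Fix a generation of birth $m_0$ and an initial function on $V_{m_0}$ (for $SG$), or a sequence $\mathcal K$, a generation of birth $m_0$ and an initial function on $V_{(m_0)}$ (for $SG_\infty$). Then there is a continuous function $g:\mathbb R\to\mathbb R$ with $g(t+\log5)=g(t)$ for all $t$ such that $$\lim_{x\to\infty}\left(\frac{\rho_{m_0}(x)}{x^{\log2/\log5}}-g(\log x)\right)=0 .$$ -/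

import Mathlib

open Filter Topology

noncomputable section

namespace Gasket

/-! ### Graph approximations of the Sierpinski gasket -/

/-- The plane. -/
abbrev Plane : Type := EuclideanSpace ℝ (Fin 2)

/-- The three boundary points `q₀ = (0,0)`, `q₁ = (1,0)`, `q₂ = (1/2, √3/2)` of the gasket. -/
def q (i : Fin 3) : Plane :=
  ![!₂[(0 : ℝ), 0], !₂[(1 : ℝ), 0], !₂[(1 / 2 : ℝ), √3 / 2]] i

/-- The contraction `F_i` of ratio `1/2` with fixed point `q_i`. -/
def F (i : Fin 3) (x : Plane) : Plane := (1 / 2 : ℝ) • x + (1 / 2 : ℝ) • q i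

/-- `F_w = F_{w₁} ∘ ⋯ ∘ F_{w_m}` for a word `w = (w₁, …, w_m)`. -/
def Fword : List (Fin 3) → Plane → Plane
  | [], x => x
  | i :: w, x => F i (Fword w x)

/-- The vertex sets: `V 0 = {q₀, q₁, q₂}` and `V (n+1) = ⋃ i, F_i (V n)`. -/
def V : ℕ → Set Plane
  | 0 => Set.range q
  | n + 1 => ⋃ i : Fin 3, F i '' V n

/-- `x ∼ₘ y`: the points are distinct corners of a common cell of level `m`. -/
def Adj (m : ℕ) (x y : Plane) : Prop :=
  ∃ (w : List (Fin 3)) (i j : Fin 3),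
    w.length = m ∧ i ≠ j ∧ x = Fword w (q i) ∧ y = Fword w (q j)

/-- `F_{𝒦,M} = F_{k_M} ∘ ⋯ ∘ F_{k_1}`, for a sequence `𝒦 = (k₁, k₂, …)` with `K n = k_{n+1}`.
With this order the blow-ups `F_{𝒦,M}⁻¹ SG = F_{k_1}⁻¹ ⋯ F_{k_M}⁻¹ SG` increase with `M`. -/
def Fseq (K : ℕ → Fin 3) : ℕ → Plane → Plane
  | 0, x => x
  | M + 1, x => F (K M) (Fseq K M x)

/-- The vertex set `V_(m) = ⋃_{M ≥ 1} F_{𝒦,M}⁻¹ V_{M+m}`, `m ∈ ℤ`, of the Sierpinski lattice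
(the union is over those `M` for which `M + m ≥ 0`). -/
def VInf (K : ℕ → Fin 3) (m : ℤ) : Set Plane :=
  {x | ∃ M n : ℕ, 1 ≤ M ∧ (n : ℤ) = M + m ∧ Fseq K M x ∈ V n}

/-- `x ∼_(m) y` in the Sierpinski lattice: `F_{𝒦,M} x ∼_{M+m} F_{𝒦,M} y` for some `M`. -/
def AdjInf (K : ℕ → Fin 3) (m : ℤ) (x y : Plane) : Prop :=
  ∃ M n : ℕ, 1 ≤ M ∧ (n : ℤ) = M + m ∧ Adj n (Fseq K M x) (Fseq K M y)

/-- A vertex of `V_(m)` that is not a boundary point of the infinite gasket. (Boundary points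
exist only if `𝒦` is eventually constant.) -/
def InteriorInf (K : ℕ → Fin 3) (m : ℤ) (x : Plane) : Prop :=
  ∃ M n : ℕ, 1 ≤ M ∧ (n : ℤ) = M + m ∧ Fseq K M x ∈ V n \ V 0

/-- The discrete Laplacian `∑_{y ∼ x} (u y - u x)` of a (locally finite) graph on the vertex
set `S`. -/
def graphLaplacian {S : Set Plane} (adj : Plane → Plane → Prop) (u : S → ℝ) (x : S) : ℝ :=
  ∑ᶠ y ∈ {y : S | adj x y}, (u y - u x)

/-- `f` is an initial function on `V_{m₀}` with initial eigenvalue `lam₀ ∈ {2, 5, 6}`: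
a nonzero function with `-Δ_{m₀} f = lam₀ f` on `V_{m₀} \ V₀`. No boundary condition is imposed,
so that Dirichlet and Neumann initial functions are both covered. -/
structure IsInitialFunction (m₀ : ℕ) (lam₀ : ℝ) (f : V m₀ → ℝ) : Prop where
  ne_zero : f ≠ 0
  forbidden : lam₀ = 2 ∨ lam₀ = 5 ∨ lam₀ = 6
  eigen : ∀ x : V m₀, (x : Plane) ∉ V 0 → -graphLaplacian (Adj m₀) f x = lam₀ * f x

/-- The same notion on the infinite gasket, for a generation of birth `m₀ ∈ ℤ`. -/
structure IsInitialFunctionInf (K : ℕ → Fin 3) (m₀ : ℤ) (lam₀ : ℝ) (f : VInf K m₀ → ℝ) :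
    Prop where
  ne_zero : f ≠ 0
  forbidden : lam₀ = 2 ∨ lam₀ = 5 ∨ lam₀ = 6
  eigen : ∀ x : VInf K m₀, InteriorInf K m₀ x →
    -graphLaplacian (AdjInf K m₀) f x = lam₀ * f x

/-! ### Spectral decimation -/

/-- `ψ₋(x) = (5 - √(25 - 4x)) / 2`. -/
def psiMinus (x : ℝ) : ℝ := (5 - √(25 - 4 * x)) / 2

/-- `ψ₊(x) = (5 + √(25 - 4x)) / 2`. -/
def psiPlus (x : ℝ) : ℝ := (5 + √(25 - 4 * x)) / 2

/-- `ψ_e = ψ_{e₁} ∘ ⋯ ∘ ψ_{e_N}` for a sequence of signs; `true` stands for `+` and `false`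
for `-`. -/
def psiWord : List Bool → ℝ → ℝ
  | [], x => x
  | true :: e, x => psiPlus (psiWord e x)
  | false :: e, x => psiMinus (psiWord e x)

/-- The index set `E`: the empty sequence and all finite sequences of signs with `e₁ = +`. -/
def E : Set (List Bool) := {e | e = [] ∨ e.head? = some true}

/-- `Ψ(x) = (3/2) lim_{l → ∞} 5^l ψ₋^l(x)`. The limit exists for `0 ≤ x ≤ 25/4`, see
`tendsto_Psi`. -/
def Psi (x : ℝ) : ℝ := 3 / 2 * limUnder atTop (fun l : ℕ => (5 : ℝ) ^ l * psiMinus^[l] x)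

/-- The eigenvalue `λ_e` with generation of birth `m₀` and initial eigenvalue `lam₀`:
`5^{|e|+m₀} Ψ(ψ_e(lam₀))` if `lam₀` is `2` or `5`, and `5^{|e|+m₀+1} Ψ(ψ_e(ψ₊(6)))` if `lam₀ = 6`
(the first step is then forced, as `ψ₋(6) = 2` is forbidden). -/
def eigenval (m₀ : ℤ) (lam₀ : ℝ) (e : List Bool) : ℝ :=
  if lam₀ = 6 then (5 : ℝ) ^ ((e.length : ℤ) + m₀ + 1) * Psi (psiWord e (psiPlus 6))
  else (5 : ℝ) ^ ((e.length : ℤ) + m₀) * Psi (psiWord e lam₀)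

/-- The eigenvalue counting function `ρ_{m₀}(x) = #{e ∈ E : λ_e ≤ x}`. The set is finite, see
`finite_eigenval_le`. -/
def rho (m₀ : ℤ) (lam₀ : ℝ) (x : ℝ) : ℕ := {e ∈ E | eigenval m₀ lam₀ e ≤ x}.ncard

/-! ### The limit and the count above are genuine -/

lemma psiMinus_spec {x : ℝ} (h0 : 0 ≤ x) (h1 : x ≤ 25 / 4) :
    0 ≤ psiMinus x ∧ psiMinus x ≤ 5 / 2 ∧ psiMinus x * (5 - psiMinus x) = x := by
  have hs := Real.sq_sqrt (show (0 : ℝ) ≤ 25 - 4 * x by linarith)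
  have hn := Real.sqrt_nonneg (25 - 4 * x)
  have h5 : √(25 - 4 * x) ≤ 5 := Real.sqrt_le_iff.2 ⟨by norm_num, by linarith⟩
  unfold psiMinus
  refine ⟨by linarith, by linarith, by nlinarith⟩

lemma psiPlus_mem {x : ℝ} (h0 : 0 ≤ x) : 5 / 2 ≤ psiPlus x ∧ psiPlus x ≤ 5 := by
  have hn := Real.sqrt_nonneg (25 - 4 * x)
  have h5 : √(25 - 4 * x) ≤ 5 := Real.sqrt_le_iff.2 ⟨by norm_num, by linarith⟩
  unfold psiPlus
  constructor <;> linarith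

lemma psiWord_mem {x : ℝ} (h0 : 0 ≤ x) (h1 : x ≤ 5) (e : List Bool) :
    0 ≤ psiWord e x ∧ psiWord e x ≤ 5 := by
  induction e with
  | nil => exact ⟨h0, h1⟩
  | cons s e ih =>
    cases s
    · have := psiMinus_spec ih.1 (by linarith [ih.2])
      exact ⟨this.1, by simp only [psiWord]; linarith [this.2.1]⟩
    · have := psiPlus_mem ih.1
      exact ⟨by simp only [psiWord]; linarith [this.1], this.2⟩

lemma iterate_psiMinus_mem {x : ℝ} (h0 : 0 ≤ x) (h1 : x ≤ 25 / 4) (l : ℕ) :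
    0 ≤ psiMinus^[l] x ∧ psiMinus^[l] x ≤ 25 / 4 := by
  induction l with
  | zero => exact ⟨h0, h1⟩
  | succ l ih =>
    rw [Function.iterate_succ_apply']
    have := psiMinus_spec ih.1 ih.2
    exact ⟨this.1, by linarith [this.2.1]⟩

lemma monotone_iterate {x : ℝ} (h0 : 0 ≤ x) (h1 : x ≤ 25 / 4) :
    Monotone (fun l : ℕ => (5 : ℝ) ^ l * psiMinus^[l] x) := by
  refine monotone_nat_of_le_succ fun l => ?_
  have hm := iterate_psiMinus_mem h0 h1 l
  have hs := psiMinus_spec hm.1 hm.2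
  rw [Function.iterate_succ_apply', pow_succ, mul_assoc]
  have h5 : (0 : ℝ) ≤ 5 ^ l := by positivity
  exact mul_le_mul_of_nonneg_left (by nlinarith) h5

lemma iterate_bound {x : ℝ} (h0 : 0 ≤ x) (h1 : x ≤ 25 / 4) (l : ℕ) :
    (5 : ℝ) ^ l * (psiMinus^[l] x / (1 - psiMinus^[l] x / 10)) ≤ x / (1 - x / 10) := by
  induction l with
  | zero => simp
  | succ l ih =>
    refine le_trans ?_ ih
    have hm := iterate_psiMinus_mem h0 h1 l
    have hs := psiMinus_spec hm.1 hm.2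
    rw [Function.iterate_succ_apply', pow_succ, mul_assoc]
    have h5 : (0 : ℝ) ≤ 5 ^ l := by positivity
    refine mul_le_mul_of_nonneg_left ?_ h5
    obtain ⟨p0, p1, p2⟩ := hs
    have hm2 := hm.2
    generalize psiMinus (psiMinus^[l] x) = p at *
    rw [← p2] at hm2 ⊢
    rw [← mul_div_assoc, div_le_div_iff₀ (by linarith) (by linarith)]
    nlinarith [mul_nonneg p0 p0, mul_nonneg (mul_nonneg p0 p0) (sub_nonneg.2 p1)]

/-- The limit that defines `Ψ` exists. -/
lemma tendsto_Psi {x : ℝ} (h0 : 0 ≤ x) (h1 : x ≤ 25 / 4) :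
    Tendsto (fun l : ℕ => 3 / 2 * ((5 : ℝ) ^ l * psiMinus^[l] x)) atTop (𝓝 (Psi x)) := by
  have hb : BddAbove (Set.range fun l : ℕ => (5 : ℝ) ^ l * psiMinus^[l] x) := by
    refine ⟨x / (1 - x / 10), ?_⟩
    rintro _ ⟨l, rfl⟩
    refine le_trans ?_ (iterate_bound h0 h1 l)
    have hm := iterate_psiMinus_mem h0 h1 l
    refine mul_le_mul_of_nonneg_left ?_ (by positivity)
    rw [le_div_iff₀ (by linarith [hm.2])]
    nlinarith [hm.1, hm.2]
  have ht := tendsto_atTop_ciSup (monotone_iterate h0 h1) hb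
  unfold Psi
  rw [ht.limUnder_eq]
  exact ht.const_mul _

lemma le_Psi {x : ℝ} (h0 : 0 ≤ x) (h1 : x ≤ 25 / 4) : x ≤ Psi x := by
  refine le_trans ?_ (((monotone_iterate h0 h1).const_mul
    (by norm_num : (0 : ℝ) ≤ 3 / 2)).ge_of_tendsto (tendsto_Psi h0 h1) 0)
  simp
  linarith

/-- Only finitely many `λ_e` lie below a given bound. -/
lemma finite_eigenval_le (m₀ : ℤ) {lam₀ : ℝ} (h : lam₀ = 2 ∨ lam₀ = 5 ∨ lam₀ = 6) (x : ℝ) :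
    {e ∈ E | eigenval m₀ lam₀ e ≤ x}.Finite := by
  have key : ∀ e ∈ E, e ≠ [] → (5 : ℝ) ^ ((e.length : ℤ) + m₀) * (5 / 2) ≤ eigenval m₀ lam₀ e := by
    intro e he hne
    have hw : ∀ y : ℝ, 0 ≤ y → y ≤ 5 → 5 / 2 ≤ Psi (psiWord e y) := by
      intro y y0 y1
      have hm := psiWord_mem y0 y1 e
      refine le_trans ?_ (le_Psi hm.1 (by linarith [hm.2]))
      obtain rfl | he := he
      · exact absurd rfl hne
      cases e with
      | nil => simp at he
      | cons s e =>
        obtain rfl : s = true := by simpa using he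
        exact (psiPlus_mem (psiWord_mem y0 y1 e).1).1
    unfold eigenval
    split_ifs with h6
    · have hp := psiPlus_mem (x := 6) (by norm_num)
      have := hw (psiPlus 6) (by linarith) hp.2
      have h5 : (0 : ℝ) < 5 ^ ((e.length : ℤ) + m₀) := by positivity
      rw [zpow_add_one₀ (by norm_num)]
      nlinarith
    · refine mul_le_mul_of_nonneg_left (hw _ ?_ ?_) (by positivity) <;>
        rcases h with h | h | h <;> first | (exact absurd h h6) | linarith
  obtain ⟨N, hN⟩ := pow_unbounded_of_one_lt (x / (5 ^ m₀ * (5 / 2))) (by norm_num : (1 : ℝ) < 5)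
  refine (List.finite_length_le Bool N).subset ?_
  rintro e ⟨he, hx⟩
  by_contra hlen
  replace hlen : N < e.length := not_le.1 hlen
  have h1 := key e he (by rintro rfl; simp at hlen)
  have hc : (0 : ℝ) < 5 ^ m₀ * (5 / 2) := by positivity
  rw [div_lt_iff₀ hc] at hN
  rw [zpow_add₀ (by norm_num), zpow_natCast] at h1
  have h2 : (5 : ℝ) ^ N ≤ 5 ^ e.length := pow_le_pow_right₀ (by norm_num) hlen.le
  nlinarith [mul_le_mul_of_nonneg_right h2 hc.le]

end Gasket

end

namespace Gasket

/-! ### Sign words -/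

/-! Since `5 Ψ(ψ₋ x) = Ψ(x)`, prefixing a `-` to a word does not change its eigenvalue. Padding with
leading `-` signs therefore turns the count into the number of words `w` of a fixed large length `N`
whose points `ψ_w(y)` lie in an initial segment of `[0, 5]`, because `Ψ` is increasing
(`orbitCount_eq_countWords`). Replacing `(N, x)` by `(N + 1, 5x)` leaves the segment unchanged, and
adding one sign doubles the number of points in any initial segment up to an error of 2
(`abs_countWords_psiWord_sub_le`). So `|ρ(5x) - 2ρ(x)| ≤ 2`. Consequently `H(x) = lim ρ(5^n x) /
2^n` exists, satisfies `H(5x) = 2H(x)` and stays within a bounded distance of `ρ`. It is continuous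
because `ρ` jumps by at most 1, a discontinuity that the division by `2^n` wipes out. The periodic
function is `g(log x) = H(x) / x^(log 2 / log 5)`. -/

/-- The finite set of sign words of length `N`. -/
def signWords : ℕ → Finset (List Bool)
  | 0 => {[]}
  | N + 1 => (signWords N).image (List.cons true) ∪ (signWords N).image (List.cons false)

/-- The finite set of words in `E` of length at most `N`. -/
def indexWords : ℕ → Finset (List Bool)
  | 0 => {[]}
  | N + 1 => indexWords N ∪ (signWords N).image (List.cons true)

lemma mem_signWords {N : ℕ} {w : List Bool} : w ∈ signWords N ↔ w.length = N := by
  induction N generalizing w with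
  | zero => simp [signWords]
  | succ N ih =>
    rcases w with _ | ⟨_ | _, w⟩ <;> simp [signWords, ih]

lemma mem_indexWords {N : ℕ} {e : List Bool} : e ∈ indexWords N ↔ e ∈ E ∧ e.length ≤ N := by
  induction N with
  | zero =>
    rcases e with _ | ⟨_ | _, e⟩ <;> simp [indexWords, E]
  | succ N ih =>
    simp only [indexWords, Finset.mem_union, ih, Finset.mem_image, mem_signWords]
    rcases e with _ | ⟨_ | _, e⟩
    · simp [E]
    · simp [E]
    · simp [E]
      omega

open Classical in
/-- The number of words in `s` that satisfy `p`. -/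
noncomputable def countWords (s : Finset (List Bool)) (p : List Bool → Prop) : ℕ :=
  (s.filter p).card

lemma countWords_true (s : Finset (List Bool)) : countWords s (fun _ => True) = s.card := by
  simp [countWords]

lemma countWords_false (s : Finset (List Bool)) : countWords s (fun _ => False) = 0 := by
  simp [countWords]

lemma countWords_le_card (s : Finset (List Bool)) (p : List Bool → Prop) :
    countWords s p ≤ s.card := by
  classical
  exact Finset.card_filter_le _ _

lemma countWords_add_countWords_not (s : Finset (List Bool)) (p : List Bool → Prop) :
    countWords s p + countWords s (fun w => ¬ p w) = s.card := by
  classical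
  unfold countWords
  convert Finset.card_filter_add_card_filter_not (s := s) p

lemma countWords_congr {s : Finset (List Bool)} {p p' : List Bool → Prop}
    (h : ∀ w ∈ s, p w ↔ p' w) : countWords s p = countWords s p' := by
  classical
  unfold countWords
  rw [Finset.filter_congr h]

lemma countWords_signWords_succ (p : List Bool → Prop) (N : ℕ) :
    countWords (signWords (N + 1)) p =
      countWords (signWords N) (fun w => p (true :: w)) +
        countWords (signWords N) (fun w => p (false :: w)) := by
  classical
  simp only [countWords]
  rw [signWords, Finset.filter_union, Finset.card_union_of_disjoint, Finset.filter_image,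
    Finset.filter_image, Finset.card_image_of_injective _ List.cons_injective,
    Finset.card_image_of_injective _ List.cons_injective]
  rw [Finset.disjoint_left]
  simp only [Finset.mem_filter, Finset.mem_image]
  rintro _ ⟨⟨a, -, rfl⟩, -⟩ ⟨⟨b, -, h⟩, -⟩
  simp at h

lemma countWords_indexWords_succ (p : List Bool → Prop) (N : ℕ) :
    countWords (indexWords (N + 1)) p =
      countWords (indexWords N) p + countWords (signWords N) (fun w => p (true :: w)) := by
  classical
  simp only [countWords]
  rw [indexWords, Finset.filter_union, Finset.card_union_of_disjoint, Finset.filter_image,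
    Finset.card_image_of_injective _ List.cons_injective]
  rw [Finset.disjoint_left]
  simp only [Finset.mem_filter, Finset.mem_image, mem_indexWords, mem_signWords]
  rintro _ ⟨⟨-, h⟩, -⟩ ⟨⟨b, hb, rfl⟩, -⟩
  simp at h
  omega

/-- Padding with leading `-` signs identifies the words in `E` of length at most `N` with all
words of length `N`. -/
lemma countWords_signWords_eq {p : List Bool → Prop} (hp : ∀ w, p (false :: w) ↔ p w) (N : ℕ) :
    countWords (signWords N) p = countWords (indexWords N) p := by
  induction N with
  | zero => rfl
  | succ N ih =>
    rw [countWords_signWords_succ, countWords_indexWords_succ, ← ih, add_comm]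
    simp only [hp]

lemma card_signWords (N : ℕ) : (signWords N).card = 2 ^ N := by
  induction N with
  | zero => rfl
  | succ N ih =>
    have := countWords_signWords_succ (fun _ => True) N
    simp only [countWords_true] at this
    rw [this, ih]
    ring

/-! ### The inverse branches -/

lemma psiMinus_mono : Monotone psiMinus := by
  intro a b h
  have := Real.sqrt_le_sqrt (show 25 - 4 * b ≤ 25 - 4 * a by linarith)
  unfold psiMinus
  linarith

lemma psiPlus_anti : Antitone psiPlus := by
  intro a b h
  have := Real.sqrt_le_sqrt (show 25 - 4 * b ≤ 25 - 4 * a by linarith)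
  unfold psiPlus
  linarith

lemma psiMinus_le (x : ℝ) : psiMinus x ≤ 5 / 2 := by
  have := Real.sqrt_nonneg (25 - 4 * x)
  unfold psiMinus
  linarith

lemma le_psiPlus (x : ℝ) : 5 / 2 ≤ psiPlus x := by
  have := Real.sqrt_nonneg (25 - 4 * x)
  unfold psiPlus
  linarith

lemma psiMinus_lt_psiPlus {a b : ℝ} (ha : a ≤ 5) : psiMinus a < psiPlus b := by
  have h := Real.sqrt_pos.2 (show 0 < 25 - 4 * a by linarith)
  have := le_psiPlus b
  have : psiMinus a < 5 / 2 := by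
    unfold psiMinus
    linarith
  linarith

lemma psiMinus_injOn : Set.InjOn psiMinus (Set.Icc 0 5) := by
  intro a ha b hb h
  have h1 := (psiMinus_spec ha.1 (by linarith [ha.2])).2.2
  have h2 := (psiMinus_spec hb.1 (by linarith [hb.2])).2.2
  rw [← h1, ← h2, h]

lemma psiPlus_injOn : Set.InjOn psiPlus (Set.Icc 0 5) := by
  intro a ha b hb h
  refine psiMinus_injOn ha hb ?_
  unfold psiPlus at h
  unfold psiMinus
  linarith

/-- On `[0, 5]` each branch is injective, and the two images are separated by `5/2`, so the
outermost sign can be read off from the value. -/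
lemma psiWord_injOn {y : ℝ} (h0 : 0 ≤ y) (h1 : y ≤ 5) (N : ℕ) :
    Set.InjOn (fun w => psiWord w y) {w | w.length = N} := by
  induction N with
  | zero =>
    intro a ha b hb _
    rw [List.length_eq_zero_iff.1 ha, List.length_eq_zero_iff.1 hb]
  | succ N ih =>
    have hm := psiWord_mem h0 h1
    intro a ha b hb h
    rcases a with _ | ⟨s, a⟩
    · simp at ha
    rcases b with _ | ⟨t, b⟩
    · simp at hb
    simp only [Set.mem_ofPred_eq, List.length_cons, add_left_inj] at ha hb
    cases s <;> cases t <;> simp only [psiWord] at h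
    · rw [ih ha hb (psiMinus_injOn (hm a) (hm b) h)]
    · exact absurd h (psiMinus_lt_psiPlus (hm a).2).ne
    · exact absurd h (psiMinus_lt_psiPlus (hm b).2).ne'
    · rw [ih ha hb (psiPlus_injOn (hm a) (hm b) h)]

/-! ### The renormalized limit `Ψ` -/

/-- With `p = ψ₋(a)` and `q = ψ₋(b)`, `b - a = (q - p)(5 - p - q) ≤ 5(q - p)`, so `5ψ₋` never
shrinks distances. A lower bound uniform in `l` keeps the monotonicity strict in the limit `Ψ`. -/
lemma le_pow_mul_iterate_psiMinus_sub {a b : ℝ} (h0 : 0 ≤ a) (hab : a ≤ b) (h1 : b ≤ 25 / 4)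
    (l : ℕ) : b - a ≤ (5 : ℝ) ^ l * psiMinus^[l] b - (5 : ℝ) ^ l * psiMinus^[l] a := by
  induction l with
  | zero => simp
  | succ l ih =>
    refine ih.trans ?_
    have ha := iterate_psiMinus_mem h0 (hab.trans h1) l
    have hb := iterate_psiMinus_mem (h0.trans hab) h1 l
    have hle := psiMinus_mono.iterate l hab
    rw [Function.iterate_succ_apply', Function.iterate_succ_apply', pow_succ]
    generalize psiMinus^[l] a = a' at *
    generalize psiMinus^[l] b = b' at *
    obtain ⟨p0, p1, p2⟩ := psiMinus_spec ha.1 ha.2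
    obtain ⟨q0, q1, q2⟩ := psiMinus_spec hb.1 hb.2
    have hpq := psiMinus_mono hle
    have h5 : (0 : ℝ) ≤ 5 ^ l := by positivity
    have : b' - a' ≤ 5 * (psiMinus b' - psiMinus a') := by
      nlinarith [mul_nonneg (sub_nonneg.2 hpq) (add_nonneg p0 q0)]
    nlinarith [mul_le_mul_of_nonneg_left this h5]

lemma Psi_strictMonoOn : StrictMonoOn Psi (Set.Icc 0 5) := by
  intro a ha b hb hab
  have h1 := tendsto_Psi ha.1 (by linarith [ha.2])
  have h2 := tendsto_Psi hb.1 (by linarith [hb.2])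
  have := ge_of_tendsto' (h2.sub h1) (b := 3 / 2 * (b - a)) fun l => by
    linarith [le_pow_mul_iterate_psiMinus_sub ha.1 hab.le (by linarith [hb.2]) l]
  linarith

/-- Shifting the index by one in the defining limit gives the functional equation. -/
lemma Psi_psiMinus {x : ℝ} (h0 : 0 ≤ x) (h1 : x ≤ 5) : 5 * Psi (psiMinus x) = Psi x := by
  have hm := psiMinus_spec h0 (by linarith)
  have h2 := (tendsto_Psi hm.1 (by linarith)).const_mul 5
  refine tendsto_nhds_unique h2 ?_
  refine ((tendsto_Psi h0 (by linarith)).comp (tendsto_add_atTop_nat 1)).congr fun l => ?_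
  simp only [Function.comp, Function.iterate_succ_apply, pow_succ]
  ring

/-! ### Counting the preimages of a point in an initial segment -/

/-- Passing from words of length `N` to words of length `N + 1` doubles the number of points
`ψ_w(y)` in an initial segment of `[0, 5]`, up to an error of at most `2`. -/
lemma abs_countWords_psiWord_sub_le (y : ℝ) (N : ℕ) (L : ℝ → Prop)
    (hL : ∀ a b, a ≤ b → L b → L a) :
    |(countWords (signWords (N + 1)) (fun w => L (psiWord w y)) : ℝ) -
      2 * countWords (signWords N) (fun w => L (psiWord w y))| ≤ 2 := by
  induction N generalizing L with
  | zero =>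
    -- The constant 2 originates here: the counts lie in `[0, 2]` and `[0, 1]`. The induction step
    -- does not enlarge the error.
    have ha := countWords_le_card (signWords 1) fun w => L (psiWord w y)
    have hb := countWords_le_card (signWords 0) fun w => L (psiWord w y)
    rw [card_signWords] at ha hb
    have ha' : (countWords (signWords 1) (fun w => L (psiWord w y)) : ℝ) ≤ 2 := by
      exact_mod_cast ha
    have hb' : (countWords (signWords 0) (fun w => L (psiWord w y)) : ℝ) ≤ 1 := by
      exact_mod_cast hb
    rw [abs_le]
    constructor <;> linarith [Nat.cast_nonneg (α := ℝ)
      (countWords (signWords 1) fun w => L (psiWord w y)), Nat.cast_nonneg (α := ℝ)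
      (countWords (signWords 0) fun w => L (psiWord w y))]
  | succ N ih =>
    -- Peel off the outermost sign. Either the segment reaches the upper branch and then contains
    -- the whole lower one, or it misses the upper branch entirely.
    by_cases h : ∃ v, L (psiPlus v)
    · obtain ⟨v, hv⟩ := h
      have hmin : ∀ u, L (psiMinus u) := fun u =>
        hL _ _ ((psiMinus_le u).trans (le_psiPlus v)) hv
      have key : ∀ n, (countWords (signWords (n + 1)) (fun w => L (psiWord w y)) : ℝ) =
          2 ^ (n + 1) - countWords (signWords n) (fun w => ¬ L (psiPlus (psiWord w y))) := by
        intro n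
        have hc := countWords_add_countWords_not (signWords n)
          (fun w => L (psiPlus (psiWord w y)))
        rw [card_signWords] at hc
        have hc' : (countWords (signWords n) (fun w => L (psiPlus (psiWord w y))) : ℝ) +
          countWords (signWords n) (fun w => ¬ L (psiPlus (psiWord w y))) = 2 ^ n := by
          exact_mod_cast hc
        rw [countWords_signWords_succ]
        simp only [psiWord, hmin, countWords_true, card_signWords]
        push_cast
        rw [pow_succ]
        linarith
      -- As `ψ₊` reverses order, the complement pulls back to an initial segment. The powers of 2
      -- cancel, so only the sign of the error changes.
      have := ih (fun v => ¬ L (psiPlus v)) fun a b hab hb ha => hb (hL _ _ (psiPlus_anti hab) ha)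
      rw [key, key, abs_sub_comm]
      convert this using 2
      ring
    · push Not at h
      have key : ∀ n, countWords (signWords (n + 1)) (fun w => L (psiWord w y)) =
          countWords (signWords n) (fun w => L (psiMinus (psiWord w y))) := by
        intro n
        rw [countWords_signWords_succ]
        simp [psiWord, h, countWords_false]
      rw [key, key]
      exact ih (fun v => L (psiMinus v)) fun a b hab hb => hL _ _ (psiMinus_mono hab) hb

/-! ### The counting function of a backward orbit -/

/-- The renormalized value `5^{|e|+m} Ψ(ψ_e(y))`. -/
noncomputable def orbitValue (m : ℤ) (y : ℝ) (e : List Bool) : ℝ :=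
  (5 : ℝ) ^ ((e.length : ℤ) + m) * Psi (psiWord e y)

/-- The number of `e ∈ E` with `5^{|e|+m} Ψ(ψ_e(y)) ≤ x`. -/
noncomputable def orbitCount (m : ℤ) (y x : ℝ) : ℕ := {e ∈ E | orbitValue m y e ≤ x}.ncard

/-- The case of 6 becomes a backward orbit started one generation later at `ψ₊(6)`, which puts every
starting point in `[0, 5]`. -/
lemma rho_eq_orbitCount {lam₀ : ℝ} (h : lam₀ = 2 ∨ lam₀ = 5 ∨ lam₀ = 6) (m₀ : ℤ) :
    ∃ (m : ℤ) (y : ℝ), 0 ≤ y ∧ y ≤ 5 ∧ ∀ x, rho m₀ lam₀ x = orbitCount m y x := by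
  by_cases h6 : lam₀ = 6
  · have hp := psiPlus_mem (x := 6) (by norm_num)
    refine ⟨m₀ + 1, psiPlus 6, by linarith, hp.2, fun x => ?_⟩
    simp only [rho, orbitCount, eigenval, orbitValue, if_pos h6, add_assoc]
  · refine ⟨m₀, lam₀, ?_, ?_, fun x => ?_⟩
    · rcases h with rfl | rfl | rfl <;> norm_num
    · rcases h with rfl | rfl | rfl <;> first | exact absurd rfl h6 | norm_num
    · simp only [rho, orbitCount, eigenval, orbitValue, if_neg h6]

section Orbit

variable {y : ℝ} (m : ℤ)

lemma orbitValue_false_cons (h0 : 0 ≤ y) (h1 : y ≤ 5) (w : List Bool) :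
    orbitValue m y (false :: w) = orbitValue m y w := by
  have hm := psiWord_mem h0 h1 w
  simp only [orbitValue, psiWord, List.length_cons]
  rw [← Psi_psiMinus hm.1 hm.2, Nat.cast_succ, add_right_comm, zpow_add_one₀ (by norm_num)]
  ring

lemma le_orbitValue_true_cons (h0 : 0 ≤ y) (h1 : y ≤ 5) (w : List Bool) :
    (5 : ℝ) ^ ((w.length : ℤ) + 1 + m) ≤ orbitValue m y (true :: w) := by
  have hm := psiWord_mem h0 h1 (true :: w)
  have hP := le_Psi hm.1 (by linarith [hm.2])
  have hp : 5 / 2 ≤ psiWord (true :: w) y := le_psiPlus _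
  have h5 : (0 : ℝ) < 5 ^ ((w.length : ℤ) + 1 + m) := by positivity
  rw [orbitValue, List.length_cons, Nat.cast_succ]
  nlinarith

/-- A word of `E` longer than `N` starts with `+`, so its value is at least `5^(N+m) > x`. The
remaining words are padded to length `N`. -/
lemma orbitCount_eq_countWords (h0 : 0 ≤ y) (h1 : y ≤ 5) {N : ℕ} {x : ℝ}
    (hx : x < (5 : ℝ) ^ ((N : ℤ) + m)) :
    orbitCount m y x = countWords (signWords N) fun w => orbitValue m y w ≤ x := by
  rw [countWords_signWords_eq (fun w => by rw [orbitValue_false_cons m h0 h1]), orbitCount,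
    countWords, ← Set.ncard_coe_finset]
  congr 1
  ext e
  simp only [Set.mem_ofPred_eq, Finset.coe_filter, mem_indexWords]
  refine ⟨fun ⟨he, hle⟩ => ⟨⟨he, ?_⟩, hle⟩, fun ⟨⟨he, _⟩, hle⟩ => ⟨he, hle⟩⟩
  rcases e with _ | ⟨_ | _, e⟩
  · simp
  · simp [E] at he
  · by_contra hlen
    rw [not_le, List.length_cons] at hlen
    have h2 : (5 : ℝ) ^ ((N : ℤ) + m) ≤ 5 ^ ((e.length : ℤ) + 1 + m) :=
      zpow_le_zpow_right₀ (by norm_num) (by omega)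
    linarith [le_orbitValue_true_cons m h0 h1 e]

lemma exists_lt_zpow_natCast_add (x : ℝ) : ∃ N : ℕ, x < (5 : ℝ) ^ ((N : ℤ) + m) := by
  obtain ⟨N, hN⟩ := pow_unbounded_of_one_lt (x / 5 ^ m) (by norm_num : (1 : ℝ) < 5)
  refine ⟨N, ?_⟩
  rw [div_lt_iff₀ (by positivity)] at hN
  rwa [zpow_add₀ (by norm_num), zpow_natCast]

/-- Scaling the argument by `5` doubles the counting function, up to a bounded error. -/
lemma abs_orbitCount_five_mul_sub_le (h0 : 0 ≤ y) (h1 : y ≤ 5) (x : ℝ) :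
    |(orbitCount m y (5 * x) : ℝ) - 2 * orbitCount m y x| ≤ 2 := by
  obtain ⟨N, hN⟩ := exists_lt_zpow_natCast_add m x
  have hpow : (5 : ℝ) ^ (((N + 1 : ℕ) : ℤ) + m) = 5 ^ ((N : ℤ) + m) * 5 := by
    rw [Nat.cast_succ, add_right_comm, zpow_add_one₀ (by norm_num)]
  have h5 : (0 : ℝ) < 5 ^ ((N : ℤ) + m) := by positivity
  rw [orbitCount_eq_countWords m h0 h1 hN,
    orbitCount_eq_countWords m h0 h1 (N := N + 1) (x := 5 * x) (by rw [hpow]; linarith)]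
  -- `Ψ` is known to increase only on `[0, 5]`, so its sublevel set there is replaced by its
  -- downward closure in `ℝ`.
  have hL : ∀ n : ℕ, ∀ t c : ℝ, 0 < c → (5 : ℝ) ^ ((n : ℤ) + m) = c →
      countWords (signWords n) (fun w => orbitValue m y w ≤ t) =
        countWords (signWords n) (fun w => psiWord w y < 0 ∨
          ∃ z, psiWord w y ≤ z ∧ 0 ≤ z ∧ z ≤ 5 ∧ Psi z ≤ t / c) := by
    intro n t c hc hnc
    refine countWords_congr fun w hw => ?_
    have hm := psiWord_mem h0 h1 w
    rw [orbitValue, mem_signWords.1 hw, hnc, ← le_div_iff₀' hc]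
    constructor
    · exact fun h => Or.inr ⟨_, le_rfl, hm.1, hm.2, h⟩
    · rintro (h | ⟨z, hz, z0, z1, h⟩)
      · linarith [hm.1]
      · exact (Psi_strictMonoOn.monotoneOn hm ⟨z0, z1⟩ hz).trans h
  rw [hL (N + 1) (5 * x) _ (by positivity) rfl, hL N x _ h5 rfl, hpow,
    show 5 * x / ((5 : ℝ) ^ ((N : ℤ) + m) * 5) = x / 5 ^ ((N : ℤ) + m) by field_simp]
  refine abs_countWords_psiWord_sub_le y N
    (fun v => v < 0 ∨ ∃ z, v ≤ z ∧ 0 ≤ z ∧ z ≤ 5 ∧ Psi z ≤ x / 5 ^ ((N : ℤ) + m)) ?_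
  rintro a b hab (h | ⟨z, hz, h⟩)
  · exact Or.inl (hab.trans_lt h)
  · exact Or.inr ⟨z, hab.trans hz, h⟩

lemma orbitValue_injOn (h0 : 0 ≤ y) (h1 : y ≤ 5) (N : ℕ) :
    Set.InjOn (orbitValue m y) {w | w.length = N} := by
  intro a ha b hb h
  have h5 : (5 : ℝ) ^ ((N : ℤ) + m) ≠ 0 := by positivity
  rw [orbitValue, orbitValue, show a.length = N from ha, show b.length = N from hb] at h
  exact psiWord_injOn h0 h1 N ha hb
    (Psi_strictMonoOn.injOn (psiWord_mem h0 h1 a) (psiWord_mem h0 h1 b) (mul_left_cancel₀ h5 h))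

/-- The jumps of the counting function have size at most `1`. -/
lemma eventually_abs_orbitCount_sub_le (h0 : 0 ≤ y) (h1 : y ≤ 5) (t : ℝ) :
    ∀ᶠ s in 𝓝 t, |(orbitCount m y s : ℝ) - orbitCount m y t| ≤ 1 := by
  classical
  obtain ⟨N, hN⟩ := exists_lt_zpow_natCast_add m t
  have hloc : ∀ᶠ s in 𝓝 t, ∀ w ∈ signWords N, orbitValue m y w ≠ t →
      (orbitValue m y w ≤ s ↔ orbitValue m y w ≤ t) := by
    rw [Filter.eventually_all_finset]
    intro w _
    rcases lt_trichotomy (orbitValue m y w) t with h | h | h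
    · filter_upwards [lt_mem_nhds h] with s hs _
      exact ⟨fun _ => h.le, fun _ => hs.le⟩
    · exact Filter.Eventually.of_forall fun s hne => absurd h hne
    · filter_upwards [gt_mem_nhds h] with s hs _
      exact ⟨fun h' => absurd h' (not_le.2 hs), fun h' => absurd h' (not_le.2 h)⟩
  -- Near `t` only words with value exactly `t` can change status, and by injectivity there is at
  -- most one.
  have hone : ((signWords N).filter fun w => orbitValue m y w = t).card ≤ 1 := by
    rw [Finset.card_le_one]
    simp only [Finset.mem_filter, mem_signWords]
    rintro a ⟨ha, ha'⟩ b ⟨hb, hb'⟩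
    exact orbitValue_injOn m h0 h1 N ha hb (ha'.trans hb'.symm)
  have hsub : ∀ u v : ℝ, (∀ w ∈ signWords N, orbitValue m y w ≠ t →
      orbitValue m y w ≤ u → orbitValue m y w ≤ v) →
      countWords (signWords N) (fun w => orbitValue m y w ≤ u) ≤
        countWords (signWords N) (fun w => orbitValue m y w ≤ v) + 1 := by
    intro u v huv
    unfold countWords
    refine le_trans (Finset.card_le_card (t := ((signWords N).filter fun w => orbitValue m y w ≤ v)
      ∪ (signWords N).filter fun w => orbitValue m y w = t) fun w hw => ?_)
      ((Finset.card_union_le _ _).trans (Nat.add_le_add_left hone _))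
    rw [Finset.mem_filter] at hw
    simp only [Finset.mem_union, Finset.mem_filter]
    by_cases hwt : orbitValue m y w = t
    · exact Or.inr ⟨hw.1, hwt⟩
    · exact Or.inl ⟨hw.1, huv w hw.1 hwt hw.2⟩
  filter_upwards [hloc, gt_mem_nhds hN] with s hs hsN
  rw [orbitCount_eq_countWords m h0 h1 hN, orbitCount_eq_countWords m h0 h1 hsN, abs_le]
  have ha : (_ : ℝ) ≤ _ := Nat.cast_le.2 (hsub s t fun w hw hne => (hs w hw hne).1)
  have hb : (_ : ℝ) ≤ _ := Nat.cast_le.2 (hsub t s fun w hw hne => (hs w hw hne).2)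
  push_cast at ha hb
  constructor <;> linarith

end Orbit

end Gasket

/-! ### Functions that are almost homogeneous under a discrete scaling -/

/-- A function that doubles up to a bounded error when its argument is multiplied by `5`, and
whose local oscillation is bounded, is at bounded distance from a continuous function that
doubles exactly. -/
lemma exists_continuous_five_mul_of_abs_sub_le {r : ℝ → ℝ} {C C' : ℝ}
    (h : ∀ x, |r (5 * x) - 2 * r x| ≤ C) (hosc : ∀ t, ∀ᶠ s in 𝓝 t, |r s - r t| ≤ C') :
    ∃ H : ℝ → ℝ, Continuous H ∧ (∀ x, H (5 * x) = 2 * H x) ∧ ∀ x, |r x - H x| ≤ C := by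
  have hdist : ∀ x, ∀ n : ℕ, dist (r (5 ^ n * x) / 2 ^ n) (r (5 ^ (n + 1) * x) / 2 ^ (n + 1)) ≤
      C / 2 / 2 ^ n := by
    intro x n
    have h2 : (0 : ℝ) < 2 ^ (n + 1) := by positivity
    rw [dist_comm, Real.dist_eq, show r (5 ^ (n + 1) * x) / 2 ^ (n + 1) - r (5 ^ n * x) / 2 ^ n =
      (r (5 * (5 ^ n * x)) - 2 * r (5 ^ n * x)) / 2 ^ (n + 1) by
        rw [pow_succ' (5 : ℝ), mul_assoc, pow_succ]; field_simp,
      abs_div, abs_of_pos h2, div_div, ← pow_succ']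
    gcongr
    exact h _
  have hlim : ∀ x, ∃ l, Tendsto (fun n : ℕ => r (5 ^ n * x) / 2 ^ n) atTop (𝓝 l) := fun x =>
    cauchySeq_tendsto_of_complete (cauchySeq_of_le_geometric_two (hdist x))
  choose H hH using hlim
  have hbound : ∀ x, |r x - H x| ≤ C := fun x => by
    simpa [Real.dist_eq] using dist_le_of_le_geometric_two_of_tendsto₀ (hdist x) (hH x)
  have hscale : ∀ x, H (5 * x) = 2 * H x := by
    intro x
    refine tendsto_nhds_unique (hH (5 * x)) ?_
    refine (((hH x).comp (tendsto_add_atTop_nat 1)).const_mul 2).congr fun n => ?_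
    simp only [Function.comp, pow_succ, mul_assoc]
    field_simp
  have hpow : ∀ n : ℕ, ∀ x, H (5 ^ n * x) = 2 ^ n * H x := by
    intro n
    induction n with
    | zero => simp
    | succ n ih => intro x; rw [pow_succ', mul_assoc, hscale, ih]; ring
  refine ⟨H, ?_, hscale, hbound⟩
  rw [continuous_iff_continuousAt]
  intro t
  rw [ContinuousAt, Metric.tendsto_nhds]
  intro ε hε
  -- At the scale `5^n t` the oscillation of `H` is at most `C'` from `r` plus `C` for each of the
  -- two comparisons; scaling back divides it by `2^n`.
  obtain ⟨n, hn⟩ := pow_unbounded_of_one_lt ((2 * C + C') / ε) (by norm_num : (1 : ℝ) < 2)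
  rw [div_lt_iff₀ hε] at hn
  have hcont : Tendsto (fun s : ℝ => 5 ^ n * s) (𝓝 t) (𝓝 (5 ^ n * t)) :=
    (continuous_const.mul continuous_id).tendsto t
  filter_upwards [hcont.eventually (hosc (5 ^ n * t))] with s hs
  rw [Real.dist_eq]
  have h2 : (0 : ℝ) < 2 ^ n := by positivity
  have hle : 2 ^ n * |H s - H t| ≤ 2 * C + C' := by
    nth_rw 1 [← abs_of_pos h2]
    rw [← abs_mul, mul_sub, ← hpow, ← hpow]
    have h3 := abs_le.1 (hbound (5 ^ n * s))
    have h4 := abs_le.1 (hbound (5 ^ n * t))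
    have h5 := abs_le.1 hs
    rw [abs_le]
    constructor <;> linarith [h3.1, h3.2, h4.1, h4.2, h5.1, h5.2]
  exact lt_of_mul_lt_mul_left (hle.trans_lt hn) h2.le

/-- A function that doubles up to a bounded error when its argument is multiplied by `5` is
asymptotic to `x ^ (log 2 / log 5)` times a continuous function of `log x` of period `log 5`. -/
lemma exists_periodic_tendsto_of_abs_sub_le {r : ℝ → ℝ} {C C' : ℝ}
    (h : ∀ x, |r (5 * x) - 2 * r x| ≤ C) (hosc : ∀ t, ∀ᶠ s in 𝓝 t, |r s - r t| ≤ C') :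
    ∃ g : ℝ → ℝ, Continuous g ∧ Function.Periodic g (Real.log 5) ∧
      Tendsto (fun x : ℝ => r x / x ^ (Real.log 2 / Real.log 5) - g (Real.log x)) atTop (𝓝 0) := by
  obtain ⟨H, hcont, hscale, hbound⟩ := exists_continuous_five_mul_of_abs_sub_le h hosc
  have hl5 : 0 < Real.log 5 := Real.log_pos (by norm_num)
  have hl2 : 0 < Real.log 2 := Real.log_pos (by norm_num)
  set α := Real.log 2 / Real.log 5 with hα
  have hα0 : 0 < α := div_pos hl2 hl5
  refine ⟨fun s => H (Real.exp s) / Real.exp (s * α), ?_, fun s => ?_, ?_⟩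
  · exact (hcont.comp Real.continuous_exp).div (by fun_prop) fun s => (Real.exp_pos _).ne'
  · have h1 : Real.exp (s + Real.log 5) = 5 * Real.exp s := by
      rw [Real.exp_add, Real.exp_log (by norm_num), mul_comm]
    have h2 : Real.exp ((s + Real.log 5) * α) = 2 * Real.exp (s * α) := by
      rw [add_mul, Real.exp_add, hα, mul_div_cancel₀ _ hl5.ne', Real.exp_log (by norm_num),
        mul_comm]
    simp only [h1, h2, hscale]
    exact mul_div_mul_left _ _ (by norm_num)
  · have hz : Tendsto (fun x : ℝ => C / x ^ α) atTop (𝓝 0) :=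
      tendsto_const_nhds.div_atTop (tendsto_rpow_atTop hα0)
    refine squeeze_zero_norm' ?_ hz
    filter_upwards [eventually_gt_atTop 0] with x hx
    have hxα : 0 < x ^ α := Real.rpow_pos_of_pos hx α
    rw [Real.exp_log hx, ← Real.rpow_def_of_pos hx, ← sub_div, Real.norm_eq_abs, abs_div,
      abs_of_pos hxα]
    gcongr
    exact hbound x

open Gasket in
/-- The counting function of the eigenvalues arising from a forbidden initial eigenvalue is
asymptotically `x ^ (log 2 / log 5)` times a continuous log-periodic function. -/
lemma exists_periodic_tendsto_rho {lam₀ : ℝ} (h : lam₀ = 2 ∨ lam₀ = 5 ∨ lam₀ = 6) (m₀ : ℤ) :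
    ∃ g : ℝ → ℝ, Continuous g ∧ Function.Periodic g (Real.log 5) ∧
      Tendsto (fun x : ℝ =>
          (rho m₀ lam₀ x : ℝ) / x ^ (Real.log 2 / Real.log 5) - g (Real.log x))
        atTop (𝓝 0) := by
  obtain ⟨m, y, h0, h1, hr⟩ := rho_eq_orbitCount h m₀
  simp only [hr]
  exact exists_periodic_tendsto_of_abs_sub_le (abs_orbitCount_five_mul_sub_le m h0 h1)
    (eventually_abs_orbitCount_sub_le m h0 h1)

open Gasket in
theorem proposition5p3 :
    -- the Sierpinski gasket
    (∀ (m₀ : ℕ) (lam₀ : ℝ) (f : V m₀ → ℝ), IsInitialFunction m₀ lam₀ f →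
      ∃ g : ℝ → ℝ, Continuous g ∧ Function.Periodic g (Real.log 5) ∧
        Tendsto (fun x : ℝ =>
            (rho m₀ lam₀ x : ℝ) / x ^ (Real.log 2 / Real.log 5) - g (Real.log x))
          atTop (𝓝 0)) ∧
    -- the infinite Sierpinski gasket
    (∀ (K : ℕ → Fin 3) (m₀ : ℤ) (lam₀ : ℝ) (f : VInf K m₀ → ℝ),
      IsInitialFunctionInf K m₀ lam₀ f →
      ∃ g : ℝ → ℝ, Continuous g ∧ Function.Periodic g (Real.log 5) ∧
        Tendsto (fun x : ℝ =>
            (rho m₀ lam₀ x : ℝ) / x ^ (Real.log 2 / Real.log 5) - g (Real.log x))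
          atTop (𝓝 0)) :=
  ⟨fun m₀ _ _ hf => exists_periodic_tendsto_rho hf.forbidden m₀,
    fun _ m₀ _ _ hf => exists_periodic_tendsto_rho hf.forbidden m₀⟩
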